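/- For $x\in\mathbb I:=(0,1)\setminus\mathbb Q$ let $a_1(x),a_2(x),\dots\in\{1,2,3,\dots\}$ denote the digits of its regular continued fraction expansion $$x=\cfrac{1}{a_1(x)+\cfrac{1}{a_2(x)+\cfrac{1}{a_3(x)+\cdots}}},$$ and for real $q$ put $\mathcal I_q:=\{x\in\mathbb I: a_i(x)\ge q\text{ for all } i\ge 1\}$. Let $\dim_H$ denote Hausdorff dimension. Then, as $q\to\infty$, $$\dim_H\mathcal I_q-\frac12\;\sim\;\frac12\,\frac{\log\log q}{\log q},$$ that is, the quotient of the two sides tends to $1$. -/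

import Mathlib

/-- The set of all irrational `x ∈ (0, 1)` with regular continued fraction expansion
`x = [0; a₁, a₂, a₃, …]` such that `aᵢ ≥ q` for every `i ≥ 1`. The sequence of partial denominators
of `GenContFract.of x` is `a₁, a₂, a₃, …` (indexed from `0`, without the integer part); it never
terminates for irrational `x`. -/
def cfDigitsGe (q : ℝ) : Set ℝ :=
  {x : ℝ | x ∈ Set.Ioo (0 : ℝ) 1 ∧ Irrational x ∧
    ∀ (n : ℕ) (a : ℝ), (GenContFract.of x).partDens.get? n = some a → q ≤ a}

open MeasureTheory Filter Set
open scoped ENNReal NNReal Topology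

/-! The set is governed by the inverse Gauss branches `u ↦ 1/(a + u)` with `a ≥ k = ⌈q⌉`, whose
derivatives on `[0,1]` lie in absolute value between `(a+1)^{-2}` and `a^{-2}`. Covering by
cylinders bounds the dimension above by `s` when `∑ a^{-2s} < 1`; a Bernoulli measure on finitely
many digits bounds it below by `s` when `∑ (a+1)^{-2s} ≥ 1`.

With `2s = 1 + t`, comparison with an integral gives both sums the size `q^{-t}/t`, so the critical
`t` nearly solves `t = q^{-t}`. For `t = c log log q / log q` one has `q^{-t} = (log q)^{-c}`, which
is smaller than `t` if `c > 1` and larger if `c < 1`, for large `q`. Hence `t ~ log log q / log q`,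
and the dimension is `1/2 + t/2`. -/

theorem GenContFract.of_fract_s (v : ℝ) :
    (GenContFract.of (Int.fract v)).s = (GenContFract.of v).s := by
  refine Stream'.Seq.ext fun n => ?_
  cases n with
  | succ n => rw [GenContFract.of_s_succ, GenContFract.of_s_succ, Int.fract_fract]
  | zero =>
    by_cases h : Int.fract v = 0
    · obtain ⟨a, rfl⟩ : ∃ a : ℤ, v = a := ⟨⌊v⌋, eq_of_sub_eq_zero h⟩
      rw [GenContFract.of_s_of_int, Int.fract_intCast]
      have := GenContFract.of_s_of_int ℝ 0
      rw [Int.cast_zero] at this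
      rw [this]
    · have h1 := GenContFract.of_s_head h
      have h2 := GenContFract.of_s_head (v := Int.fract v) (by rwa [Int.fract_fract])
      rw [Int.fract_fract] at h2
      exact h2.trans h1.symm

theorem GenContFract.of_s_succ_of_mem_Ioo {x : ℝ} (hx : x ∈ Ioo (0 : ℝ) 1) (n : ℕ) :
    (GenContFract.of x).s.get? (n + 1) = (GenContFract.of (Int.fract x⁻¹)).s.get? n := by
  rw [GenContFract.of_s_succ, GenContFract.of_fract_s,
    Int.fract_eq_self.2 ⟨hx.1.le, hx.2⟩]

theorem GenContFract.of_s_zero_of_mem_Ioo {x : ℝ} (hx : x ∈ Ioo (0 : ℝ) 1) :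
    (GenContFract.of x).s.get? 0 = some ⟨1, (⌊x⁻¹⌋ : ℤ)⟩ := by
  have hf : Int.fract x = x := Int.fract_eq_self.2 ⟨hx.1.le, hx.2⟩
  have := GenContFract.of_s_head (v := x) (by rw [hf]; exact hx.1.ne')
  rw [hf] at this
  exact this

/-- The first digit of a point of `cfDigitsGe q` is at least `q`, and its image under the Gauss map
belongs to `cfDigitsGe q` again. -/
theorem le_floor_and_fract_mem_of_mem_cfDigitsGe {q x : ℝ} (hx : x ∈ cfDigitsGe q) :
    q ≤ (⌊x⁻¹⌋ : ℤ) ∧ Int.fract x⁻¹ ∈ cfDigitsGe q := by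
  obtain ⟨h01, hirr, hdig⟩ := hx
  have hirr' : Irrational (Int.fract x⁻¹) := by
    have : Irrational (x⁻¹ - (⌊x⁻¹⌋ : ℤ)) := hirr.inv.sub_intCast _
    exact this
  refine ⟨hdig 0 _ (GenContFract.partDen_eq_s_b (GenContFract.of_s_zero_of_mem_Ioo h01)),
    ⟨lt_of_le_of_ne (Int.fract_nonneg _) hirr'.ne_zero.symm, Int.fract_lt_one _⟩, hirr', ?_⟩
  intro n a ha
  obtain ⟨gp, hgp, rfl⟩ := GenContFract.exists_s_b_of_partDen ha
  refine hdig (n + 1) _ (GenContFract.partDen_eq_s_b ?_)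
  rw [GenContFract.of_s_succ_of_mem_Ioo h01, hgp]

/-! ### Upper bound: covers by cylinders -/

/-- A set covered by its own images under countably many contractions of ratios `r a` with
`∑ (r a) ^ s < 1` is null for the `s`-dimensional Hausdorff measure. -/
theorem hausdorffMeasure_eq_zero_of_subset_iUnion_image {X : Type*} [EMetricSpace X]
    [MeasurableSpace X] [BorelSpace X] {E D : Set X} {φ : ℕ → X → X} {r : ℕ → ℝ≥0} {ρ : ℝ≥0}
    (hρ : ρ < 1) (hr : ∀ a, r a ≤ ρ) (hlip : ∀ a, LipschitzOnWith (r a) (φ a) D)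
    (hmaps : ∀ a, MapsTo (φ a) D D) (hED : E ⊆ D) (hD : Metric.ediam D ≤ 1)
    (hE : E ⊆ ⋃ a, φ a '' E) {s : ℝ} (hs : 0 < s) (hsum : ∑' a, (r a : ℝ≥0∞) ^ s < 1) :
    μH[s] E = 0 := by
  have key : ∀ n : ℕ, ∃ t : ℕ → Set X, (∀ i, t i ⊆ D) ∧ E ⊆ ⋃ i, t i ∧
      (∀ i, Metric.ediam (t i) ≤ (ρ : ℝ≥0∞) ^ n) ∧
      ∑' i, Metric.ediam (t i) ^ s ≤ (∑' a, (r a : ℝ≥0∞) ^ s) ^ n := by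
    intro n
    induction n with
    | zero =>
      refine ⟨fun i => if i = 0 then D else ∅, ?_, ?_, ?_, ?_⟩
      · intro i; dsimp only; split_ifs <;> simp
      · exact hED.trans (subset_iUnion_of_subset 0 (by simp))
      · intro i; dsimp only; split_ifs <;> simp [hD]
      -- The padding empty sets contribute `0 ^ s`, which vanishes because `s > 0`.
      · rw [tsum_eq_single 0 (by intro i hi; simp [hi, hs])]
        simpa using ENNReal.rpow_le_one hD hs.le
    | succ n ih =>
      obtain ⟨t, htD, htE, htd, hts⟩ := ih
      let e : ℕ ≃ ℕ × ℕ := (Denumerable.eqv (ℕ × ℕ)).symm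
      have hd : ∀ a i, Metric.ediam (φ a '' t i) ≤ r a * Metric.ediam (t i) := fun a i =>
        Metric.ediam_image_le_iff.2 fun x hx y hy =>
          ((hlip a) (htD i hx) (htD i hy)).trans
            (mul_le_mul_right (Metric.edist_le_ediam_of_mem hx hy) _)
      refine ⟨fun i => φ (e i).1 '' t (e i).2, ?_, ?_, ?_, ?_⟩
      · intro i
        exact (image_mono (htD _)).trans (hmaps _).image_subset
      · intro x hx
        obtain ⟨a, y, hy, rfl⟩ := mem_iUnion.1 (hE hx)
        obtain ⟨i, hi⟩ := mem_iUnion.1 (htE hy)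
        refine mem_iUnion.2 ⟨e.symm (a, i), ?_⟩
        simp only [Equiv.apply_symm_apply]
        exact mem_image_of_mem _ hi
      · intro i
        refine (hd _ _).trans ?_
        rw [pow_succ']
        exact mul_le_mul' (by exact_mod_cast hr _) (htd _)
      · calc ∑' i, Metric.ediam (φ (e i).1 '' t (e i).2) ^ s
            = ∑' p : ℕ × ℕ, Metric.ediam (φ p.1 '' t p.2) ^ s :=
              e.tsum_eq (fun p : ℕ × ℕ => Metric.ediam (φ p.1 '' t p.2) ^ s)
          _ ≤ ∑' p : ℕ × ℕ, (r p.1 : ℝ≥0∞) ^ s * Metric.ediam (t p.2) ^ s := by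
              refine ENNReal.tsum_le_tsum fun p => ?_
              rw [← ENNReal.mul_rpow_of_nonneg _ _ hs.le]
              exact ENNReal.rpow_le_rpow (hd _ _) hs.le
          _ = (∑' a, (r a : ℝ≥0∞) ^ s) * ∑' i, Metric.ediam (t i) ^ s := by
              rw [ENNReal.tsum_prod', ← ENNReal.tsum_mul_right]
              simp_rw [ENNReal.tsum_mul_left]
          _ ≤ _ := by
              rw [pow_succ']
              gcongr
  choose t _ htE htd hts using key
  have hle := Measure.hausdorffMeasure_le_liminf_tsum s E (l := atTop)
    (fun n : ℕ => (ρ : ℝ≥0∞) ^ n)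
    (ENNReal.tendsto_pow_atTop_nhds_zero_of_lt_one (by exact_mod_cast hρ)) t
    (Eventually.of_forall htd) (Eventually.of_forall htE)
  have hlim : Tendsto (fun n => ∑' i, Metric.ediam (t n i) ^ s) atTop (𝓝 0) :=
    tendsto_of_tendsto_of_tendsto_of_le_of_le tendsto_const_nhds
      (ENNReal.tendsto_pow_atTop_nhds_zero_of_lt_one hsum) (fun _ => zero_le) hts
  rw [hlim.liminf_eq] at hle
  exact le_antisymm hle zero_le

theorem abs_inv_add_sub_inv_add {a u v : ℝ} (hu : 0 < a + u) (hv : 0 < a + v) :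
    |(a + u)⁻¹ - (a + v)⁻¹| = |u - v| / ((a + u) * (a + v)) := by
  rw [inv_sub_inv hu.ne' hv.ne', abs_div, abs_of_pos (mul_pos hu hv), abs_sub_comm]
  congr 2
  ring

theorem lipschitzOnWith_inv_add {a : ℝ≥0} (ha : 0 < a) :
    LipschitzOnWith ((a ^ 2)⁻¹) (fun u : ℝ => ((a : ℝ) + u)⁻¹) (Icc 0 1) := by
  have ha' : (0 : ℝ) < a := ha
  refine LipschitzOnWith.of_dist_le_mul fun u hu v hv => ?_
  have hu1 : (a : ℝ) ≤ a + u := by linarith [hu.1]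
  have hv1 : (a : ℝ) ≤ a + v := by linarith [hv.1]
  rw [Real.dist_eq, Real.dist_eq, abs_inv_add_sub_inv_add (by linarith) (by linarith), div_eq_inv_mul]
  gcongr
  push_cast
  rw [sq]
  exact inv_anti₀ (mul_pos ha' ha') (mul_le_mul hu1 hv1 ha'.le (by linarith))

/-- If `∑_{a ≥ k} a^{-2s} < 1` then continued fractions with digits at least `q`, where
`k = ⌈q⌉₊`, form a set of dimension at most `s`. -/
theorem dimH_cfDigitsGe_le {q : ℝ} {k : ℕ} (hk : 2 ≤ k) (hkq : k = ⌈q⌉₊) {s : ℝ≥0} (hs : 0 < s)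
    (hsum : ∑' a : ℕ, ENNReal.ofReal (((k : ℝ) + a) ^ (-(2 * s : ℝ))) < 1) :
    dimH (cfDigitsGe q) ≤ s := by
  refine dimH_le_of_hausdorffMeasure_ne_top (ne_of_eq_of_ne ?_ ENNReal.zero_ne_top)
  have hpos : ∀ a : ℕ, (0 : ℝ≥0) < k + a := fun a => by
    have : (0 : ℝ≥0) < k := by exact_mod_cast (by omega : 0 < k)
    positivity
  refine hausdorffMeasure_eq_zero_of_subset_iUnion_image (D := Icc 0 1)
    (φ := fun a u => (((k + a : ℝ≥0) : ℝ) + u)⁻¹) (r := fun a => ((k + a : ℝ≥0) ^ 2)⁻¹)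
    (ρ := 1 / 2) (by
      rw [div_lt_one (by norm_num)]; norm_num) ?_ (fun a => lipschitzOnWith_inv_add (hpos a)) ?_
    (fun x hx => ⟨hx.1.1.le, hx.1.2.le⟩) ?_ ?_ (by exact_mod_cast hs) ?_
  · intro a
    rw [one_div]
    gcongr
    have h2 : (2 : ℝ≥0) ≤ k + a := by exact_mod_cast (by omega : 2 ≤ k + a)
    calc (2 : ℝ≥0) ≤ k + a := h2
      _ ≤ (k + a) ^ 2 := le_self_pow₀ (le_trans (by norm_num) h2) (by norm_num)
  · intro a u hu
    have h2 : (2 : ℝ) ≤ k + a := by exact_mod_cast (by omega : 2 ≤ k + a)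
    push_cast
    exact ⟨inv_nonneg.2 (by linarith [hu.1]), inv_le_one_of_one_le₀ (by linarith [hu.1])⟩
  · simp [Real.ediam_Icc]
  · intro x hx
    obtain ⟨h1, h2⟩ := le_floor_and_fract_mem_of_mem_cfDigitsGe hx
    have hfl : (k : ℤ) ≤ ⌊x⁻¹⌋ := by
      have h0 : 0 ≤ ⌊x⁻¹⌋ := Int.floor_nonneg.2 (inv_nonneg.2 hx.1.1.le)
      lift ⌊x⁻¹⌋ to ℕ using h0 with m
      rw [hkq]
      exact_mod_cast Nat.ceil_le.2 (by exact_mod_cast h1)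
    refine mem_iUnion.2 ⟨(⌊x⁻¹⌋ - k).toNat, Int.fract x⁻¹, h2, ?_⟩
    have : (((⌊x⁻¹⌋ - k).toNat : ℤ) : ℝ) = ⌊x⁻¹⌋ - k := by
      rw [Int.toNat_of_nonneg (by omega)]; push_cast; ring
    rw [Int.cast_natCast] at this
    push_cast
    rw [this, add_sub_cancel, Int.floor_add_fract, inv_inv]
  · refine lt_of_le_of_lt (ENNReal.tsum_le_tsum fun a => le_of_eq ?_) hsum
    have hp : (0 : ℝ) < k + a := by exact_mod_cast hpos a
    rw [← ENNReal.ofReal_coe_nnreal, ENNReal.ofReal_rpow_of_nonneg (by positivity) (by positivity)]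
    congr 1
    push_cast
    rw [Real.rpow_neg hp.le, Real.inv_rpow (by positivity), Real.rpow_mul hp.le]
    norm_num

/-! ### Lower bound: mass distribution -/

/-- Upper bound for the product measure of a set contained in a cylinder. -/
theorem infinitePi_cylinder_le {A : Type*} [MeasurableSpace A] [MeasurableSingletonClass A]
    (p : Measure A) [IsProbabilityMeasure p] {ℓ : A → ℝ≥0∞} {s : ℝ} (hs : 0 ≤ s)
    (hp : ∀ a, p {a} ≤ ℓ a ^ s) (ω : ℕ → A) (n : ℕ) {V : Set (ℕ → A)}
    (hV : ∀ ω' ∈ V, ∀ i < n, ω' i = ω i) :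
    Measure.infinitePi (fun _ : ℕ => p) V ≤ (∏ i ∈ Finset.range n, ℓ (ω i)) ^ s := by
  have hsub : V ⊆ Set.pi (Finset.range n : Finset ℕ) (fun i => {ω i}) := fun ω' h i hi =>
    hV ω' h i (by simpa using hi)
  calc _ ≤ Measure.infinitePi (fun _ : ℕ => p)
        (Set.pi (Finset.range n : Finset ℕ) (fun i => {ω i})) := measure_mono hsub
    _ = ∏ i ∈ Finset.range n, p {ω i} :=
        Measure.infinitePi_pi _ fun i _ => measurableSet_singleton _
    _ ≤ ∏ i ∈ Finset.range n, ℓ (ω i) ^ s := Finset.prod_le_prod' fun i _ => hp _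
    _ = _ := (ENNReal.prod_rpow_of_nonneg hs).symm ▸ rfl

/-- Mass distribution principle for a limit set coded by sequences: if points whose codes first
differ at `n` are separated by the product of the ratios of the first `n` letters, and if the
letters have probabilities at most the `s`-th powers of the ratios, then the limit set has dimension
at least `s`. -/
theorem le_dimH_range_of_separated {A X : Type*} [Finite A] [TopologicalSpace A]
    [DiscreteTopology A] [MeasurableSpace A] [BorelSpace A] [EMetricSpace X]
    {f : (ℕ → A) → X} (hf : Continuous f) (p : Measure A) [IsProbabilityMeasure p]
    {ℓ : A → ℝ≥0∞} {ρ c : ℝ≥0} (hρ : ρ < 1) (hℓ : ∀ a, ℓ a ≤ ρ) (hc : 0 < c) {s : ℝ≥0} (hs : 0 < s)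
    (hp : ∀ a, p {a} ≤ ℓ a ^ (s : ℝ))
    (hsep : ∀ n (ω ω' : ℕ → A), (∀ i < n, ω' i = ω i) → ω' n ≠ ω n →
      c * ∏ i ∈ Finset.range n, ℓ (ω i) ≤ edist (f ω) (f ω')) :
    (s : ℝ≥0∞) ≤ dimH (range f) := by
  borelize X
  have hs' : (0 : ℝ) < s := hs
  set μ := Measure.infinitePi (fun _ : ℕ => p)
  have hfm : Measurable f := hf.measurable
  have hcs0 : (c : ℝ≥0∞) ^ (s : ℝ) ≠ 0 := by simp [hc.ne']
  have hV : ∀ U : Set X, (c : ℝ≥0∞) ^ (s : ℝ) * μ (f ⁻¹' U) ≤ Metric.ediam U ^ (s : ℝ) := by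
    intro U
    -- If two codes of points of `U` differ, the first such place bounds the mass by a cylinder and
    -- the diameter by the separation. Otherwise there is at most one code, and a single code has
    -- mass zero.
    by_cases hne : ∃ n, ∃ ω ∈ f ⁻¹' U, ∃ ω' ∈ f ⁻¹' U, ω' n ≠ ω n
    · classical
      obtain ⟨ω, hω, ω', hω', hn⟩ := Nat.find_spec hne
      have hmin : ∀ i < Nat.find hne, ∀ η ∈ f ⁻¹' U, η i = ω i := by
        intro i hi η hη
        by_contra hcon
        exact Nat.find_min hne hi ⟨ω, hω, η, hη, hcon⟩
      calc (c : ℝ≥0∞) ^ (s : ℝ) * μ (f ⁻¹' U)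
          ≤ (c : ℝ≥0∞) ^ (s : ℝ) * (∏ i ∈ Finset.range (Nat.find hne), ℓ (ω i)) ^ (s : ℝ) := by
            gcongr
            exact infinitePi_cylinder_le p hs'.le hp ω _ fun η hη i hi => hmin i hi η hη
        _ = (c * ∏ i ∈ Finset.range (Nat.find hne), ℓ (ω i)) ^ (s : ℝ) :=
            (ENNReal.mul_rpow_of_nonneg _ _ hs'.le).symm
        _ ≤ Metric.ediam U ^ (s : ℝ) := by
            refine ENNReal.rpow_le_rpow ((hsep _ ω ω' (fun i hi => hmin i hi ω' hω') hn).trans ?_)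
              hs'.le
            exact Metric.edist_le_ediam_of_mem hω hω'
    · push Not at hne
      suffices h : μ (f ⁻¹' U) = 0 by simp [h]
      rcases (f ⁻¹' U).eq_empty_or_nonempty with h | ⟨ω, hω⟩
      · simp [h]
      have hb : ∀ n : ℕ, μ (f ⁻¹' U) ≤ ((ρ : ℝ≥0∞) ^ (s : ℝ)) ^ n := by
        intro n
        refine (infinitePi_cylinder_le p hs'.le hp ω n fun η hη i _ => hne i ω hω η hη).trans ?_
        rw [← ENNReal.rpow_natCast, ← ENNReal.rpow_mul, mul_comm, ENNReal.rpow_mul,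
          ENNReal.rpow_natCast]
        refine ENNReal.rpow_le_rpow ?_ hs'.le
        refine (Finset.prod_le_prod' fun i _ => hℓ (ω i)).trans ?_
        simp
      refine le_antisymm (ge_of_tendsto' (ENNReal.tendsto_pow_atTop_nhds_zero_of_lt_one
        (ENNReal.rpow_lt_one (by exact_mod_cast hρ) hs')) hb) zero_le
  have hle : (c : ℝ≥0∞) ^ (s : ℝ) • μ.map f ≤ μH[s] := by
    refine Measure.le_hausdorffMeasure _ _ 1 one_pos fun U _ => ?_
    -- Passing to the closure makes the set measurable and keeps its diameter.
    rw [Measure.smul_apply, smul_eq_mul, ← Metric.ediam_closure U]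
    refine le_trans ?_ (hV (closure U))
    rw [← Measure.map_apply hfm isClosed_closure.measurableSet]
    gcongr
    exact subset_closure
  refine le_dimH_of_hausdorffMeasure_ne_zero (ne_bot_of_le_ne_bot ?_ (hle (range f)))
  rw [Measure.smul_apply, smul_eq_mul,
    Measure.map_apply hfm (isCompact_range hf).isClosed.measurableSet, preimage_range, measure_univ,
    mul_one]
  exact hcs0

/-! ### Coding by continued fractions with finitely many digits -/

/-- The continuous coding map that sends `ω` to the continued fraction with digits `k + ω i`. -/
theorem exists_continuous_contFract_coding {k : ℕ} (hk : 2 ≤ k) (N : ℕ) :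
    ∃ f : (ℕ → Fin N) → ℝ, Continuous f ∧ ∀ ω, f ω ∈ Icc (0 : ℝ) 1 ∧
      f ω = ((k : ℝ) + ω 0 + f (fun n => ω (n + 1)))⁻¹ := by
  have hk' : (2 : ℝ) ≤ k := by exact_mod_cast hk
  have hpos : ∀ (i : Fin N) (u : Icc (0 : ℝ) 1), (2 : ℝ) ≤ k + i + u := fun i u => by
    have := u.2.1
    have : (0 : ℝ) ≤ (i : ℕ) := Nat.cast_nonneg _
    linarith
  have hcont : ∀ F : C(ℕ → Fin N, Icc (0 : ℝ) 1), Continuous fun ω : ℕ → Fin N =>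
      ((k : ℝ) + ω 0 + F (fun n => ω (n + 1)))⁻¹ := by
    intro F
    have h1 : Continuous fun ω : ℕ → Fin N => (((ω 0 : Fin N) : ℕ) : ℝ) :=
      (continuous_of_discreteTopology (f := fun i : Fin N => ((i : ℕ) : ℝ))).comp
        (continuous_apply 0)
    have h2 : Continuous fun ω : ℕ → Fin N => ((F (fun n => ω (n + 1)) : Icc (0 : ℝ) 1) : ℝ) :=
      continuous_subtype_val.comp (F.continuous.comp (by fun_prop))
    exact ((continuous_const.add h1).add h2).inv₀ fun ω => by
      have := hpos (ω 0) (F (fun n => ω (n + 1))); positivity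
  -- The coding is the fixed point of the functional equation's operator, a contraction in the sup
  -- metric since all denominators are at least 2.
  let T : C(ℕ → Fin N, Icc (0 : ℝ) 1) → C(ℕ → Fin N, Icc (0 : ℝ) 1) := fun F =>
    ⟨fun ω => ⟨((k : ℝ) + ω 0 + F (fun n => ω (n + 1)))⁻¹, by
        have := hpos (ω 0) (F (fun n => ω (n + 1))); positivity,
        inv_le_one_of_one_le₀ (by linarith [hpos (ω 0) (F (fun n => ω (n + 1)))])⟩,
      (hcont F).subtype_mk _⟩
  have hT : ContractingWith (1 / 2) T := by
    refine ⟨by rw [div_lt_one (by norm_num)]; norm_num, LipschitzWith.of_dist_le_mul fun F G => ?_⟩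
    refine (ContinuousMap.dist_le (by positivity)).2 fun ω => ?_
    have h1 := hpos (ω 0) (F (fun n => ω (n + 1)))
    have h2 := hpos (ω 0) (G (fun n => ω (n + 1)))
    have h3 : |((F (fun n => ω (n + 1)) : Icc (0 : ℝ) 1) : ℝ) - G (fun n => ω (n + 1))| ≤ dist F G :=
      ContinuousMap.dist_apply_le_dist (f := F) (g := G) _
    change |((k : ℝ) + ω 0 + F (fun n => ω (n + 1)))⁻¹ - ((k : ℝ) + ω 0 + G (fun n => ω (n + 1)))⁻¹|
      ≤ _
    rw [abs_inv_add_sub_inv_add (by linarith) (by linarith), div_eq_inv_mul]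
    push_cast
    refine mul_le_mul ?_ h3 (abs_nonneg _) (by norm_num)
    rw [one_div]
    exact inv_anti₀ (by norm_num) (by nlinarith)
  have : Nonempty C(ℕ → Fin N, Icc (0 : ℝ) 1) := ⟨ContinuousMap.const _ 0⟩
  have hfix := hT.fixedPoint_isFixedPt
  set F := hT.fixedPoint T
  refine ⟨fun ω => F ω, continuous_subtype_val.comp F.continuous, fun ω => ⟨(F ω).2, ?_⟩⟩
  have h : T F ω = F ω := by rw [hfix]
  exact (congrArg Subtype.val h).symm

section Coding

variable {k N : ℕ} {f : (ℕ → Fin N) → ℝ}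

theorem coding_mem_Ioo (hk : 2 ≤ k)
    (hf : ∀ ω, f ω ∈ Icc (0 : ℝ) 1 ∧ f ω = ((k : ℝ) + ω 0 + f (fun n => ω (n + 1)))⁻¹)
    (ω : ℕ → Fin N) : 0 < f ω ∧ f ω ≤ 1 / 2 := by
  have hk' : (2 : ℝ) ≤ k := by exact_mod_cast hk
  have h0 : (0 : ℝ) ≤ (ω 0 : ℕ) := Nat.cast_nonneg _
  have h1 := (hf (fun n => ω (n + 1))).1.1
  rw [(hf ω).2]
  refine ⟨inv_pos.2 (by linarith), ?_⟩
  rw [one_div]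
  exact inv_anti₀ (by norm_num) (by linarith)

/-- The coding conjugates the shift to the Gauss map, so the digits can be read off inductively.
They never terminate, which forces irrationality. -/
theorem coding_mem_cfDigitsGe (hk : 2 ≤ k) {q : ℝ} (hq : q ≤ k)
    (hf : ∀ ω, f ω ∈ Icc (0 : ℝ) 1 ∧ f ω = ((k : ℝ) + ω 0 + f (fun n => ω (n + 1)))⁻¹)
    (ω : ℕ → Fin N) : f ω ∈ cfDigitsGe q := by
  have hIoo : ∀ ω, f ω ∈ Ioo (0 : ℝ) 1 := fun ω =>
    ⟨(coding_mem_Ioo hk hf ω).1, by linarith [(coding_mem_Ioo hk hf ω).2]⟩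
  have hinv : ∀ ω, (f ω)⁻¹ = ((k + ω 0 : ℕ) : ℤ) + f (fun n => ω (n + 1)) := fun ω => by
    rw [(hf ω).2, inv_inv]; push_cast; ring
  have hfloor : ∀ ω, ⌊(f ω)⁻¹⌋ = ((k + ω 0 : ℕ) : ℤ) := fun ω => by
    rw [hinv, Int.floor_intCast_add, Int.floor_eq_zero_iff.2 (Ioo_subset_Ico_self (hIoo _)),
      add_zero]
  have hfract : ∀ ω, Int.fract (f ω)⁻¹ = f (fun n => ω (n + 1)) := fun ω => by
    rw [hinv, Int.fract_intCast_add, Int.fract_eq_self.2 ⟨(hIoo _).1.le, (hIoo _).2⟩]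
  have hs : ∀ n ω, (GenContFract.of (f ω)).s.get? n = some ⟨1, ((k + ω n : ℕ) : ℝ)⟩ := by
    intro n
    induction n with
    | zero =>
      intro ω
      rw [GenContFract.of_s_zero_of_mem_Ioo (hIoo ω), hfloor, Int.cast_natCast]
    | succ n ih =>
      intro ω
      rw [GenContFract.of_s_succ_of_mem_Ioo (hIoo ω), hfract, ih]
  refine ⟨hIoo ω, ?_, fun n a ha => ?_⟩
  · rintro ⟨r, hr⟩
    obtain ⟨n, hn⟩ := (GenContFract.terminates_iff_rat (f ω)).2 ⟨r, hr.symm⟩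
    have h1 : (GenContFract.of (f ω)).s.get? n = none := hn
    rw [hs] at h1
    exact Option.some_ne_none _ h1
  · rw [GenContFract.partDen_eq_s_b (hs n ω), Option.some.injEq] at ha
    rw [← ha]
    push_cast
    have h0 : (0 : ℝ) ≤ (ω n : ℕ) := Nat.cast_nonneg _
    linarith

/-- Tails lie in `(0, 1/2]`, so distinct first digits leave a gap of at least `1/2` between
denominators bounded by `k + N + 1`. Each common leading digit `a` then shrinks distances by a
factor no smaller than `(a + 1)^{-2}`. -/
theorem coding_separated (hk : 2 ≤ k)
    (hf : ∀ ω, f ω ∈ Icc (0 : ℝ) 1 ∧ f ω = ((k : ℝ) + ω 0 + f (fun n => ω (n + 1)))⁻¹) (n : ℕ) :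
    ∀ ω ω' : ℕ → Fin N, (∀ i < n, ω' i = ω i) → ω' n ≠ ω n →
      (2 * ((k : ℝ) + N + 1) ^ 2)⁻¹ * ∏ i ∈ Finset.range n, (((k : ℝ) + ω i + 1) ^ 2)⁻¹
        ≤ |f ω - f ω'| := by
  have hk' : (2 : ℝ) ≤ k := by exact_mod_cast hk
  induction n with
  | zero =>
    intro ω ω' _ hne
    have hu := coding_mem_Ioo hk hf (fun n => ω (n + 1))
    have hv := coding_mem_Ioo hk hf (fun n => ω' (n + 1))
    rw [(hf ω).2, (hf ω').2]
    set u := f (fun n => ω (n + 1))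
    set v := f (fun n => ω' (n + 1))
    have ha0 : (0 : ℝ) ≤ (ω 0 : ℕ) := Nat.cast_nonneg _
    have hb0 : (0 : ℝ) ≤ (ω' 0 : ℕ) := Nat.cast_nonneg _
    have haN : ((ω 0 : ℕ) : ℝ) ≤ N := by exact_mod_cast (ω 0).2.le
    have hbN : ((ω' 0 : ℕ) : ℝ) ≤ N := by exact_mod_cast (ω' 0).2.le
    have hab : (1 : ℝ) ≤ |((ω' 0 : ℕ) : ℝ) - (ω 0 : ℕ)| := by
      have : (1 : ℤ) ≤ |((ω' 0 : ℕ) : ℤ) - (ω 0 : ℕ)| := by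
        apply Int.one_le_abs
        intro h
        exact hne (Fin.ext (by omega))
      exact_mod_cast this
    have hnum : 1 / 2 ≤ |((k : ℝ) + (ω' 0 : ℕ) + v) - ((k : ℝ) + (ω 0 : ℕ) + u)| := by
      rcases le_abs.1 hab with h | h
      · exact le_abs.2 (Or.inl (by linarith))
      · exact le_abs.2 (Or.inr (by linarith))
    have hU : 0 < (k : ℝ) + (ω 0 : ℕ) + u := by linarith
    have hV : 0 < (k : ℝ) + (ω' 0 : ℕ) + v := by linarith
    rw [inv_sub_inv hU.ne' hV.ne', abs_div, abs_of_pos (mul_pos hU hV), Finset.range_zero,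
      Finset.prod_empty, mul_one, le_div_iff₀ (mul_pos hU hV)]
    refine le_trans ?_ hnum
    rw [inv_mul_le_iff₀ (by positivity)]
    have : ((k : ℝ) + (ω 0 : ℕ) + u) * ((k : ℝ) + (ω' 0 : ℕ) + v) ≤ ((k : ℝ) + N + 1) * (k + N + 1) :=
      mul_le_mul (by linarith) (by linarith) (by linarith) (by positivity)
    nlinarith
  | succ n ih =>
    intro ω ω' heq hne
    have hu := coding_mem_Ioo hk hf (fun n => ω (n + 1))
    have hv := coding_mem_Ioo hk hf (fun n => ω' (n + 1))
    have h := ih (fun n => ω (n + 1)) (fun n => ω' (n + 1)) (fun i hi => heq _ (by omega)) hne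
    have ha0 : (0 : ℝ) ≤ (ω 0 : ℕ) := Nat.cast_nonneg _
    rw [(hf ω).2, (hf ω').2, heq 0 (by omega), abs_inv_add_sub_inv_add (by linarith) (by linarith),
      Finset.prod_range_succ', ← mul_assoc, div_eq_mul_inv]
    refine mul_le_mul h ?_ (by positivity) (abs_nonneg _)
    refine inv_anti₀ (mul_pos (by linarith) (by linarith)) ?_
    rw [sq]
    exact mul_le_mul (by linarith) (by linarith) (by linarith) (by linarith)

end Coding

/-- If the digits `k, …, k + N - 1` satisfy `∑ (a + 1)^{-2s} ≥ 1` then continued fractions with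
digits at least `q ≤ k` form a set of dimension at least `s`. -/
theorem le_dimH_cfDigitsGe {q : ℝ} {k N : ℕ} (hk : 2 ≤ k) (hq : q ≤ k) {s : ℝ≥0} (hs : 0 < s)
    (hsum : 1 ≤ ∑ a ∈ Finset.range N, ((k : ℝ) + a + 1) ^ (-(2 * s : ℝ))) :
    (s : ℝ≥0∞) ≤ dimH (cfDigitsGe q) := by
  obtain ⟨f, hfc, hf⟩ := exists_continuous_contFract_coding hk N
  have hk' : (2 : ℝ) ≤ k := by exact_mod_cast hk
  set w : Fin N → ℝ := fun a => ((k : ℝ) + (a : ℕ) + 1) ^ (-(2 * s : ℝ))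
  have hw0 : ∀ a, 0 ≤ w a := fun a => by positivity
  have hW : 1 ≤ ∑ a, w a := by
    rwa [Fin.sum_univ_eq_sum_range (fun a => ((k : ℝ) + a + 1) ^ (-(2 * s : ℝ))) N]
  let P : PMF (Fin N) := PMF.ofFintype (fun a => ENNReal.ofReal (w a / ∑ b, w b)) (by
    rw [← ENNReal.ofReal_sum_of_nonneg fun a _ => div_nonneg (hw0 a) (by linarith),
      ← Finset.sum_div, div_self (by linarith), ENNReal.ofReal_one])
  have hdim := le_dimH_range_of_separated (A := Fin N) hfc P.toMeasure
    (ℓ := fun a => ENNReal.ofReal (((k : ℝ) + (a : ℕ) + 1) ^ 2)⁻¹) (ρ := 1 / 2)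
    (c := (2 * ((k : ℝ≥0) + N + 1) ^ 2)⁻¹) (by rw [div_lt_one (by norm_num)]; norm_num)
    ?_ (by positivity) hs ?_ ?_
  · exact hdim.trans (dimH_mono (range_subset_iff.2 (coding_mem_cfDigitsGe hk hq hf)))
  · intro a
    rw [ENNReal.ofReal_le_iff_le_toReal (by simp)]
    have h0 : (0 : ℝ) ≤ (a : ℕ) := Nat.cast_nonneg _
    have e : ((1 / 2 : ℝ≥0) : ℝ) = 2⁻¹ := by norm_num
    rw [ENNReal.coe_toReal, e]
    exact inv_anti₀ (by norm_num) (by nlinarith)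
  · intro a
    have hb : (0 : ℝ) < (k : ℝ) + (a : ℕ) + 1 := by positivity
    rw [PMF.toMeasure_apply_singleton _ _ (measurableSet_singleton _),
      ENNReal.ofReal_rpow_of_nonneg (by positivity) (by positivity)]
    refine ENNReal.ofReal_le_ofReal ?_
    -- Normalising divides by a total weight at least 1, so it only lowers the weights.
    refine (div_le_self (hw0 a) hW).trans (le_of_eq ?_)
    simp only [w]
    rw [Real.rpow_neg hb.le, Real.inv_rpow (by positivity), Real.rpow_mul hb.le]
    norm_num
  · intro n ω ω' heq hne
    have h := coding_separated hk hf n ω ω' heq hne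
    rw [edist_dist, Real.dist_eq, ← ENNReal.ofReal_prod_of_nonneg fun i _ => by positivity,
      ← ENNReal.ofReal_coe_nnreal, ← ENNReal.ofReal_mul (by positivity)]
    refine ENNReal.ofReal_le_ofReal (le_trans (le_of_eq ?_) h)
    push_cast
    rfl

/-! ### Power sums and explicit dimension bounds -/

/-- This is the tangent-line inequality for the convex function `x ^ (-t)`. No order between `x` and
`y` is needed: `y = x - 1` and `y = x + 1` telescope to the upper and lower sum estimates. -/
theorem rpow_neg_sub_rpow_neg_le {x y t : ℝ} (hx : 0 < x) (hy : 0 < y) (ht : 0 ≤ t) :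
    x ^ (-t) - y ^ (-t) ≤ t * (y - x) * x ^ (-(1 + t)) := by
  have h1 : y ^ (-t) = x ^ (-t) * Real.exp (-t * Real.log (y / x)) := by
    rw [Real.log_div hy.ne' hx.ne', Real.rpow_def_of_pos hx, Real.rpow_def_of_pos hy, ← Real.exp_add]
    ring_nf
  have h2 : 1 - t * (y / x - 1) ≤ Real.exp (-t * Real.log (y / x)) := by
    have h3 := Real.log_le_sub_one_of_pos (div_pos hy hx)
    have h4 := Real.add_one_le_exp (-t * Real.log (y / x))
    nlinarith
  have h5 : x ^ (-(1 + t)) = x ^ (-t) * x⁻¹ := by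
    rw [neg_add, add_comm, Real.rpow_add hx, Real.rpow_neg_one]
  have h6 : t * (y - x) * (x ^ (-t) * x⁻¹) = x ^ (-t) * (t * (y / x - 1)) := by
    field_simp
  rw [h1, h5, h6]
  nlinarith [Real.rpow_pos_of_pos hx (-t)]

theorem sum_rpow_neg_le {k t : ℝ} (hk : 1 < k) (ht : 0 < t) (n : ℕ) :
    t * ∑ a ∈ Finset.range n, (k + a) ^ (-(1 + t)) ≤ (k - 1) ^ (-t) := by
  suffices h : t * ∑ a ∈ Finset.range n, (k + a) ^ (-(1 + t))
      ≤ (k - 1) ^ (-t) - (k + n - 1) ^ (-t) by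
    have : 0 ≤ (k + n - 1) ^ (-t) :=
      Real.rpow_nonneg (by linarith [(Nat.cast_nonneg n : (0 : ℝ) ≤ n)]) _
    linarith
  induction n with
  | zero => simp
  | succ n ih =>
    have h0 : (0 : ℝ) ≤ n := Nat.cast_nonneg n
    have h := rpow_neg_sub_rpow_neg_le (x := k + n) (y := k + n - 1) (by linarith) (by linarith)
      ht.le
    have e : k + ((n + 1 : ℕ) : ℝ) - 1 = k + n := by push_cast; ring
    rw [Finset.sum_range_succ, mul_add, e]
    linarith

theorem le_sum_rpow_neg {k t : ℝ} (hk : 0 < k) (ht : 0 < t) (n : ℕ) :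
    k ^ (-t) - (k + n) ^ (-t) ≤ t * ∑ a ∈ Finset.range n, (k + a) ^ (-(1 + t)) := by
  induction n with
  | zero => simp
  | succ n ih =>
    have h0 : (0 : ℝ) ≤ n := Nat.cast_nonneg n
    have h := rpow_neg_sub_rpow_neg_le (x := k + n) (y := k + n + 1) (by linarith) (by linarith)
      ht.le
    have e : k + ((n + 1 : ℕ) : ℝ) = k + n + 1 := by push_cast; ring
    rw [Finset.sum_range_succ, mul_add, e]
    linarith

theorem dimH_cfDigitsGe_toReal_le {q t : ℝ} (hq : 2 < q) (ht : 0 < t) (h : (q - 1) ^ (-t) < t) :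
    (dimH (cfDigitsGe q)).toReal ≤ 1 / 2 + t / 2 := by
  have hs : 0 ≤ 1 / 2 + t / 2 := by positivity
  have hqk : q ≤ ⌈q⌉₊ := Nat.le_ceil q
  have hk : 2 < ⌈q⌉₊ := Nat.lt_ceil.2 (by exact_mod_cast hq)
  have hle := dimH_cfDigitsGe_le (q := q) hk.le rfl (s := (1 / 2 + t / 2).toNNReal)
    (Real.toNNReal_pos.2 (by positivity)) (by
    have hlt : ENNReal.ofReal ((q - 1) ^ (-t) / t) < 1 := by
      rw [ENNReal.ofReal_lt_one, div_lt_one ht]; exact h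
    refine lt_of_le_of_lt (ENNReal.tsum_le_of_sum_range_le fun n => ?_) hlt
    rw [← ENNReal.ofReal_sum_of_nonneg fun a _ => by positivity]
    refine ENNReal.ofReal_le_ofReal ?_
    rw [le_div_iff₀' ht]
    have e : -(2 * (1 / 2 + t / 2)) = -(1 + t) := by ring
    simp only [Real.coe_toNNReal _ hs, e]
    refine (sum_rpow_neg_le (by linarith) ht n).trans ?_
    exact Real.rpow_le_rpow_of_nonpos (by linarith) (by linarith) (by linarith))
  exact (ENNReal.toReal_mono ENNReal.coe_ne_top hle).trans_eq (Real.coe_toNNReal _ hs)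

theorem le_dimH_cfDigitsGe_toReal {q t : ℝ} (hq : 1 < q) (ht : 0 < t) (h : t < (q + 2) ^ (-t)) :
    1 / 2 + t / 2 ≤ (dimH (cfDigitsGe q)).toReal := by
  have hs : 0 ≤ 1 / 2 + t / 2 := by positivity
  have hqk : (⌈q⌉₊ : ℝ) < q + 1 := Nat.ceil_lt_add_one (by linarith)
  have hk : 1 < ⌈q⌉₊ := Nat.lt_ceil.2 (by exact_mod_cast hq)
  have hk0 : (0 : ℝ) < ⌈q⌉₊ + 1 := by positivity
  have hlim : Tendsto (fun n : ℕ => ((⌈q⌉₊ : ℝ) + 1) ^ (-t) - (⌈q⌉₊ + 1 + n) ^ (-t)) atTop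
      (𝓝 (((⌈q⌉₊ : ℝ) + 1) ^ (-t) - 0)) :=
    tendsto_const_nhds.sub ((tendsto_rpow_neg_atTop ht).comp
      (tendsto_atTop_add_const_left _ _ tendsto_natCast_atTop_atTop))
  have hgt : t < ((⌈q⌉₊ : ℝ) + 1) ^ (-t) - 0 := by
    rw [sub_zero]
    exact h.trans_le (Real.rpow_le_rpow_of_nonpos hk0 (by linarith) (by linarith))
  -- The strict inequality leaves room to truncate to finitely many digits.
  obtain ⟨N, hN⟩ := (hlim.eventually (lt_mem_nhds hgt)).exists
  have hle := le_dimH_cfDigitsGe (q := q) (N := N) hk (Nat.le_ceil q)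
    (s := (1 / 2 + t / 2).toNNReal)
    (Real.toNNReal_pos.2 (by positivity)) (by
    have e : -(2 * (1 / 2 + t / 2)) = -(1 + t) := by ring
    simp only [Real.coe_toNNReal _ hs, e]
    have h1 := hN.trans_le (le_sum_rpow_neg hk0 ht N)
    simp only [add_right_comm _ _ (1 : ℝ)]
    nlinarith)
  exact (Real.coe_toNNReal _ hs).symm.trans_le (ENNReal.toReal_mono (Real.dimH_ne_top _) hle)

/-! ### Asymptotics of `t = q^{-t}` -/

theorem eventually_rpow_neg_lt {c : ℝ} (hc : 1 < c) :
    ∀ᶠ q : ℝ in atTop, (q - 1) ^ (-(c * (Real.log (Real.log q) / Real.log q)))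
      < c * (Real.log (Real.log q) / Real.log q) := by
  have hL := Real.tendsto_log_atTop
  filter_upwards [eventually_ge_atTop 2, hL.eventually_ge_atTop (c * Real.log 2 / (c - 1)),
    hL.eventually_gt_atTop 0, (hL.comp hL).eventually_ge_atTop 1] with q hq h1 hL0 hLL
  rw [Function.comp_apply] at hLL
  rw [div_le_iff₀ (by linarith)] at h1
  have h2 : Real.log q - Real.log 2 ≤ Real.log (q - 1) := by
    rw [← Real.log_div (by linarith) (by norm_num)]
    exact Real.log_le_log (by linarith) (by linarith)
  -- The factor `c > 1` absorbs the shift from `q` to `q - 1`.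
  have h3 : Real.log q ≤ Real.log (q - 1) * c := by nlinarith
  have h4 : Real.log (Real.log q) ≤
      Real.log (q - 1) * (c * (Real.log (Real.log q) / Real.log q)) := by
    rw [← mul_assoc, mul_div_assoc', le_div_iff₀ hL0, mul_comm]
    exact mul_le_mul_of_nonneg_right h3 (by linarith)
  calc (q - 1) ^ (-(c * (Real.log (Real.log q) / Real.log q)))
      ≤ Real.exp (-Real.log (Real.log q)) := by
        rw [Real.rpow_def_of_pos (by linarith)]
        exact Real.exp_le_exp.2 (by linarith)
    _ = 1 / Real.log q := by rw [Real.exp_neg, Real.exp_log hL0, one_div]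
    _ < c * (Real.log (Real.log q) / Real.log q) := by
        rw [mul_div_assoc']
        exact div_lt_div_of_pos_right (by nlinarith) hL0

/-- The exponent `(1 + c)/2` lies between `c` and 1: the room above `c` absorbs the shift to `q +
2`, and the room below 1 absorbs the factor `log log q`. -/
theorem eventually_lt_rpow_neg {c : ℝ} (hc0 : 0 < c) (hc : c < 1) :
    ∀ᶠ q : ℝ in atTop, c * (Real.log (Real.log q) / Real.log q)
      < (q + 2) ^ (-(c * (Real.log (Real.log q) / Real.log q))) := by
  have hL := Real.tendsto_log_atTop
  have hlog := hL.eventually ((isLittleO_log_rpow_atTop (r := (1 - c) / 2) (by linarith)).bound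
    one_pos)
  filter_upwards [eventually_ge_atTop 1, hL.eventually_ge_atTop (c * Real.log 3 / ((1 - c) / 2)),
    hL.eventually_gt_atTop 0, (hL.comp hL).eventually_ge_atTop 1, hlog] with q hq h1 hL0 hLL hlog
  rw [Function.comp_apply] at hLL
  rw [div_le_iff₀ (by linarith)] at h1
  rw [Real.norm_of_nonneg (by linarith), Real.norm_of_nonneg (by positivity), one_mul] at hlog
  have h2 : Real.log (q + 2) ≤ Real.log 3 + Real.log q := by
    rw [← Real.log_mul (by norm_num) (by linarith)]
    exact Real.log_le_log (by linarith) (by linarith)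
  have h3 : Real.log (q + 2) * c ≤ (1 + c) / 2 * Real.log q := by nlinarith
  have h4 : Real.log (q + 2) * (c * (Real.log (Real.log q) / Real.log q)) ≤
      Real.log (Real.log q) * ((1 + c) / 2) := by
    rw [← mul_assoc, mul_div_assoc', div_le_iff₀ hL0]
    nlinarith
  calc c * (Real.log (Real.log q) / Real.log q)
      < Real.log q ^ ((1 - c) / 2) / Real.log q := by
        rw [mul_div_assoc']
        exact div_lt_div_of_pos_right (by nlinarith) hL0
    _ = Real.exp (-(Real.log (Real.log q) * ((1 + c) / 2))) := by
        rw [← Real.rpow_sub_one hL0.ne', Real.rpow_def_of_pos hL0]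
        ring_nf
    _ ≤ (q + 2) ^ (-(c * (Real.log (Real.log q) / Real.log q))) := by
        rw [Real.rpow_def_of_pos (by linarith)]
        exact Real.exp_le_exp.2 (by linarith)

theorem mainTheorem2 :
    Filter.Tendsto
      (fun q : ℝ => ((dimH (cfDigitsGe q)).toReal - 1 / 2) /
        (1 / 2 * (Real.log (Real.log q) / Real.log q)))
      Filter.atTop (nhds 1) := by
  have hL := Real.tendsto_log_atTop
  have hpos : ∀ᶠ q : ℝ in atTop, 0 < Real.log (Real.log q) / Real.log q := by
    filter_upwards [hL.eventually_gt_atTop 0, (hL.comp hL).eventually_gt_atTop 0] with q h1 h2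
    exact div_pos h2 h1
  refine tendsto_order.2 ⟨fun c hc => ?_, fun c hc => ?_⟩
  -- Taking `b` above `max c 0` keeps `t` positive even when `c` is negative.
  · obtain ⟨b, hb, hb1⟩ := exists_between (max_lt hc one_pos)
    rw [max_lt_iff] at hb
    filter_upwards [hpos, eventually_gt_atTop 1, eventually_lt_rpow_neg hb.2 hb1] with q hq hq1 h
    have := le_dimH_cfDigitsGe_toReal hq1 (mul_pos hb.2 hq) h
    rw [lt_div_iff₀ (by positivity)]
    nlinarith
  · obtain ⟨b, hb, hbc⟩ := exists_between hc
    filter_upwards [hpos, eventually_gt_atTop 2, eventually_rpow_neg_lt hb] with q hq hq2 h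
    have := dimH_cfDigitsGe_toReal_le hq2 (mul_pos (by linarith) hq) h
    rw [div_lt_iff₀ (by positivity)]
    nlinarith
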